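/- All graphs are finite and simple; "$H$-free" means having no induced subgraph isomorphic to $H$; $\omega$ and $\chi$ denote clique number and chromatic number. $P_3\cup P_2$ is the disjoint union of the paths on three and on two vertices, and the diamond is $K_4$ minus an edge. A graph $G$ is perfect if $\chi(H)=\omega(H)$ for every induced subgraph $H$ of $G$. **Theorem.** Let $G$ be a $\{P_3\cup P_2,\ \text{diamond}\}$-free graph. Then $$\chi(G)\le\begin{cases}4 & \text{if }\omega(G)=2,\\ 6 & \text{if }\omega(G)=3,\\ 4 & \text{if }\omega(G)=4,\end{cases}$$ and $G$ is perfect if $\omega(G)\ge 5$. Moreover, these bounds are optimal for every value of $\omega(G)\ge 2$: - the Grötzsch graph $\mu(C_5)$ (the Mycielskian of the 5-cycle) is $\{P_3\cup P_2,\text{diamond}\}$-free with $\omega=2$ and $\chi=4$; - the complement of the Schläfli graph (the 10-regular graph whose vertices are the 27 lines on a smooth cubic surface, two distinct lines being adjacent if and only if they meet, where lines are labelled $a_i,b_i$ $(1\le i\le 6)$ and $c_{ij}$ $(1\le i<j\le 6)$ and the meeting pairs are exactly: $a_i,b_j$ with $i\ne j$; $a_i,c_{jk}$ and $b_i,c_{jk}$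 with $i\in\{j,k\}$; $c_{ij},c_{kl}$ with $\{i,j\}\cap\{k,l\}=\emptyset$) is $\{P_3\cup P_2,\text{diamond}\}$-free with $\omega=3$ and $\chi=6$; - for every $n\ge 4$, the complete graph $K_n$ is $\{P_3\cup P_2,\text{diamond}\}$-free with $\omega=\chi=n$. -/

import Mathlib

namespace PThreePTwo

/-- The disjoint union `P₃ ∪ P₂` of the paths on three and on two vertices. -/
abbrev pathThreeUnionPathTwo : SimpleGraph (Fin 3 ⊕ Fin 2) :=
  SimpleGraph.pathGraph 3 ⊕g SimpleGraph.pathGraph 2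

/-- The diamond: the complete graph on four vertices minus one edge. -/
abbrev diamond : SimpleGraph (Fin 4) :=
  (⊤ : SimpleGraph (Fin 4)).deleteEdges {s(0, 1)}

/-- `G` is `{P₃ ∪ P₂, diamond}`-free: no induced subgraph of `G` is isomorphic to `P₃ ∪ P₂` or to
the diamond. -/
def IsFree {V : Type*} (G : SimpleGraph V) : Prop :=
  ¬ pathThreeUnionPathTwo.IsIndContained G ∧ ¬ diamond.IsIndContained G

/-- A graph is perfect if every induced subgraph has equal chromatic number and clique number. -/
def IsPerfect {V : Type*} (G : SimpleGraph V) : Prop :=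
  ∀ s : Set V, (G.induce s).chromaticNumber = ((G.induce s).cliqueNum : ℕ∞)

/-- Adjacency in the Mycielskian of `G`, on the original vertices `inl v`, their copies
`inr (inl v)` and an apex `inr (inr ())`. -/
def MycielskianAdj {V : Type*} (G : SimpleGraph V) : V ⊕ (V ⊕ Unit) → V ⊕ (V ⊕ Unit) → Prop
  | .inl u, .inl v => G.Adj u v
  | .inl u, .inr (.inl v) => G.Adj u v
  | .inr (.inl u), .inl v => G.Adj u v
  | .inr (.inl _), .inr (.inr _) => True
  | .inr (.inr _), .inr (.inl _) => True
  | _, _ => False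

/-- The Mycielskian `μ(G)`: each copy is adjacent to the neighbours in `G` of its original, and
the apex is adjacent to exactly the copies. -/
def mycielskian {V : Type*} (G : SimpleGraph V) : SimpleGraph (V ⊕ (V ⊕ Unit)) where
  Adj := MycielskianAdj G
  symm := ⟨by
    rintro (u | u | u) (v | v | v) h <;> first | exact SimpleGraph.Adj.symm (G := G) h | exact h⟩
  loopless := ⟨by
    rintro (u | u | u) h
    · exact G.irrefl h
    · exact h
    · exact h⟩

/-- The Grötzsch graph `μ(C₅)`. -/
def grotzschGraph : SimpleGraph (Fin 5 ⊕ (Fin 5 ⊕ Unit)) :=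
  mycielskian (SimpleGraph.cycleGraph 5)

/-- Labels of the 27 lines on a smooth cubic surface: `a i`, `b i` for `i < 6` (a double six), and
`c s` for each 2-element subset `s` of the six indices. -/
inductive Line : Type
  | a : Fin 6 → Line
  | b : Fin 6 → Line
  | c : {s : Finset (Fin 6) // s.card = 2} → Line

/-- Incidence of the 27 lines: `a i` meets `b j` iff `i ≠ j`; `a i` and `b i` meet `c s` iff
`i ∈ s`; `c s` meets `c t` iff `s` and `t` are disjoint; no other two distinct lines meet. -/
def Line.Meets : Line → Line → Prop
  | .a i, .b j => i ≠ j
  | .b i, .a j => i ≠ j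
  | .a i, .c s => i ∈ s.1
  | .c s, .a i => i ∈ s.1
  | .b i, .c s => i ∈ s.1
  | .c s, .b i => i ∈ s.1
  | .c s, .c t => Disjoint s.1 t.1
  | _, _ => False

theorem Line.Meets.symm : ∀ {x y : Line}, x.Meets y → y.Meets x := by
  rintro (i | i | s) (j | j | t) h <;>
    first | exact Ne.symm h | exact Disjoint.symm h | exact h

/-- The (16-regular) Schläfli graph: two of the 27 lines are adjacent when they are distinct and
do not meet. -/
def schlafliGraph : SimpleGraph Line where
  Adj x y := x ≠ y ∧ ¬ x.Meets y
  symm := ⟨fun _ _ h => ⟨h.1.symm, fun h' => h.2 h'.symm⟩⟩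
  loopless := ⟨fun _ h => h.1 rfl⟩

end PThreePTwo

namespace PThreePTwo

open SimpleGraph

variable {V : Type*} {G : SimpleGraph V}

/-! ### The forbidden subgraphs -/

/-! Everything is read off from a maximum clique K, of size n. Diamond-freeness and maximality give
each vertex outside K at most one neighbour in K (`eq_of_adj`), so such a vertex is either attached
to a single clique vertex or far from K. An induced path on three vertices whose vertices all miss
two fixed members of K would form P₃ ∪ P₂ with the edge between those two; hence the vertices
missing them both induce a disjoint union of cliques (`trans`). The larger n is, the more vertices
this covers.

For n = 2 the two neighbourhoods of the clique vertices are independent and the far vertices form a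
union of cliques of size at most two, so 2 + 2 colours suffice. For n = 3 and n = 4 the far vertices
have degree less than 6 and 4 respectively and can be coloured last; only K and the attached
vertices need an explicit colouring. For n ≥ 5 any three vertices outside K miss two members of K,
so the whole complement of K is a union of cliques. In an induced subgraph each of these cliques is
then coloured compatibly with what remains of K, by a list colouring argument based on Hall's
theorem (`isPerfect`).

For sharpness, the upper bounds on the chromatic numbers of the two special graphs come from the
theorem itself. The lower bounds come from a verified exhaustive search on bit masks
(`refute_sound`). In the intersection graph of the 27 lines, freeness follows from two incidence
facts: an edge lies in only one triangle, and every line meets some line of each triangle. -/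

theorem pathThreeUnionPathTwo_isIndContained_iff : pathThreeUnionPathTwo.IsIndContained G ↔
    ∃ a b c d e, G.Adj a b ∧ G.Adj b c ∧ a ≠ c ∧ G.Adj d e ∧ ¬ G.Adj a c ∧ ¬ G.Adj a d ∧
      ¬ G.Adj a e ∧ ¬ G.Adj b d ∧ ¬ G.Adj b e ∧ ¬ G.Adj c d ∧ ¬ G.Adj c e := by
  constructor
  · rintro ⟨f⟩
    have key : ∀ x y, G.Adj (f x) (f y) ↔ pathThreeUnionPathTwo.Adj x y := fun x y => f.map_adj_iff
    refine ⟨f (.inl 0), f (.inl 1), f (.inl 2), f (.inr 0), f (.inr 1), ?_⟩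
    simp [key, pathGraph_adj]
  · rintro ⟨a, b, c, d, e, hab, hbc, hac, hde, h1, h2, h3, h4, h5, h6, h7⟩
    -- Identifying a path vertex with an end of the edge would turn a required non-edge into that
    -- edge, so only `a ≠ c` has to be assumed.
    have had : a ≠ d := fun h => h3 (h ▸ hde)
    have hae : a ≠ e := fun h => h2 (h ▸ hde.symm)
    have hbd : b ≠ d := fun h => h5 (h ▸ hde)
    have hbe : b ≠ e := fun h => h4 (h ▸ hde.symm)
    have hcd : c ≠ d := fun h => h7 (h ▸ hde)
    have hce : c ≠ e := fun h => h6 (h ▸ hde.symm)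
    refine ⟨⟨⟨Sum.elim ![a, b, c] ![d, e], ?_⟩, ?_⟩⟩
    · have := hab.ne
      have := hbc.ne
      have := hde.ne
      rintro (i | i) (j | j) <;> fin_cases i <;> fin_cases j <;> simp [*, Ne.symm, eq_comm]
    · have hn : ∀ {x y}, ¬ G.Adj x y → ¬ G.Adj y x := fun h h' => h h'.symm
      intro i j
      change G.Adj (Sum.elim ![a, b, c] ![d, e] i) (Sum.elim ![a, b, c] ![d, e] j) ↔ _
      rcases i with i | i <;> rcases j with j | j <;> fin_cases i <;> fin_cases j <;>
        simp [pathGraph_adj, *, hab.symm, hbc.symm, hde.symm, hn h1, hn h2, hn h3, hn h4, hn h5,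
          hn h6, hn h7]

theorem diamond_isIndContained_iff : diamond.IsIndContained G ↔
    ∃ a b c d, G.Adj c d ∧ G.Adj a c ∧ G.Adj a d ∧ G.Adj b c ∧ G.Adj b d ∧ a ≠ b ∧
      ¬ G.Adj a b := by
  constructor
  · rintro ⟨f⟩
    have key : ∀ x y, G.Adj (f x) (f y) ↔ diamond.Adj x y := fun x y => f.map_adj_iff
    refine ⟨f 0, f 1, f 2, f 3, ?_⟩
    simp [key]
  · rintro ⟨a, b, c, d, hcd, hac, had, hbc, hbd, hne, hab⟩
    refine ⟨⟨⟨![a, b, c, d], ?_⟩, ?_⟩⟩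
    · have := hcd.ne
      have := hac.ne
      have := had.ne
      have := hbc.ne
      have := hbd.ne
      intro i j
      fin_cases i <;> fin_cases j <;> simp [*, Ne.symm, eq_comm]
    · have hab' : ¬ G.Adj b a := fun h => hab h.symm
      intro i j
      change G.Adj (![a, b, c, d] i) (![a, b, c, d] j) ↔ _
      fin_cases i <;> fin_cases j <;>
        simp [*, hcd.symm, hac.symm, had.symm, hbc.symm, hbd.symm]

theorem isFree_iff : IsFree G ↔
    (∀ a b c d e, G.Adj a b → G.Adj b c → a ≠ c → G.Adj d e →
      G.Adj a c ∨ G.Adj a d ∨ G.Adj a e ∨ G.Adj b d ∨ G.Adj b e ∨ G.Adj c d ∨ G.Adj c e) ∧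
    (∀ a b c d, G.Adj c d → G.Adj a c → G.Adj a d → G.Adj b c → G.Adj b d →
      a = b ∨ G.Adj a b) := by
  rw [IsFree, pathThreeUnionPathTwo_isIndContained_iff, diamond_isIndContained_iff]
  push Not
  refine and_congr ?_ ?_
  · refine forall_congr' fun a => forall_congr' fun b => forall_congr' fun c =>
      forall_congr' fun d => forall_congr' fun e => ?_
    tauto
  · refine forall_congr' fun a => forall_congr' fun b => forall_congr' fun c =>
      forall_congr' fun d => ?_
    tauto

/-! ### Colouring lemmas -/

/-- Vertices of degree less than the number of colours can be coloured last. -/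
theorem exists_coloring_of_degree_lt [Finite V] {α : Type*} [Fintype α] (C : Set V) (col : V → α)
    (hcol : ∀ x ∉ C, ∀ y ∉ C, G.Adj x y → col x ≠ col y)
    (hdeg : ∀ c ∈ C, (G.neighborSet c).ncard < Fintype.card α) : Nonempty (G.Coloring α) := by
  classical
  have := Fintype.ofFinite V
  have key : ∀ T : Finset V, (T : Set V) ⊆ C → ∃ f : V → α,
      ∀ x, (x ∉ C ∨ x ∈ T) → ∀ y, (y ∉ C ∨ y ∈ T) → G.Adj x y → f x ≠ f y := by
    intro T
    induction T using Finset.induction_on with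
    | empty => exact fun _ => ⟨col, by simpa using hcol⟩
    | insert c T hc ih =>
      intro hT
      rw [Finset.coe_insert, Set.insert_subset_iff] at hT
      obtain ⟨f, hf⟩ := ih hT.2
      have hlt : ((G.neighborFinset c).image f).card < (Finset.univ : Finset α).card := by
        refine Finset.card_image_le.trans_lt ?_
        have := hdeg c hT.1
        rwa [← coe_neighborFinset, Set.ncard_coe_finset] at this
      obtain ⟨a, -, ha⟩ := Finset.exists_mem_notMem_of_card_lt_card hlt
      have ha' : ∀ y, G.Adj c y → f y ≠ a := by
        intro y hy hya
        exact ha (Finset.mem_image.2 ⟨y, by simpa using hy, hya⟩)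
      refine ⟨Function.update f c a, fun x hx y hy hxy => ?_⟩
      by_cases hxc : x = c
      · subst hxc
        rw [Function.update_self, Function.update_of_ne hxy.ne']
        exact (ha' y hxy).symm
      · rw [Function.update_of_ne hxc]
        by_cases hyc : y = c
        · subst hyc
          rw [Function.update_self]
          exact ha' x hxy.symm
        · rw [Function.update_of_ne hyc]
          refine hf x ?_ y ?_ hxy
          · simpa [hxc] using hx
          · simpa [hyc] using hy
  obtain ⟨f, hf⟩ := key (Set.toFinite C).toFinset (by simp)
  exact ⟨Coloring.mk f fun {x y} hxy => hf x (by simp [em']) y (by simp [em']) hxy⟩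

/-- A graph that is a disjoint union of cliques on `R` can be coloured clique by clique. -/
theorem exists_coloring_of_transOn [Finite V] {α : Type*} (R : Set V) (L : V → α → Prop)
    (hR : ∀ x ∈ R, ∀ y ∈ R, ∀ z ∈ R, G.Adj x y → G.Adj y z → x ≠ z → G.Adj x z)
    (hL : ∀ D : Finset V, (D : Set V) ⊆ R → G.IsClique D →
      ∃ f : V → α, Set.InjOn f D ∧ ∀ x ∈ D, L x (f x)) :
    ∃ f : V → α, (∀ x ∈ R, L x (f x)) ∧ ∀ x ∈ R, ∀ y ∈ R, G.Adj x y → f x ≠ f y := by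
  classical
  have := Fintype.ofFinite V
  let comp : V → Finset V := fun x => {y | y ∈ R ∧ (y = x ∨ G.Adj x y)}
  have hcomp : ∀ x y, y ∈ comp x ↔ y ∈ R ∧ (y = x ∨ G.Adj x y) := by simp [comp]
  have hsub : ∀ x, (comp x : Set V) ⊆ R := fun x y hy => ((hcomp x y).1 hy).1
  have hclique : ∀ x ∈ R, G.IsClique (comp x) := by
    intro x hx y hy z hz hyz
    obtain ⟨hyR, hy⟩ := (hcomp x y).1 hy
    obtain ⟨hzR, hz⟩ := (hcomp x z).1 hz
    rcases hy with rfl | hy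
    · exact hz.resolve_left hyz.symm
    · rcases hz with rfl | hz
      · exact hy.symm
      · exact hR y hyR x hx z hzR hy.symm hz hyz
  have hself : ∀ x ∈ R, x ∈ comp x := fun x hx => (hcomp x x).2 ⟨hx, .inl rfl⟩
  have hle : ∀ x ∈ R, ∀ y ∈ R, G.Adj x y → comp y ⊆ comp x := by
    intro x hx y hy hxy z hz
    obtain ⟨hzR, hz⟩ := (hcomp y z).1 hz
    refine (hcomp x z).2 ⟨hzR, ?_⟩
    rcases hz with rfl | hz
    · exact .inr hxy
    · exact or_iff_not_imp_left.2 fun hne => hR x hx y hy z hzR hxy hz (Ne.symm hne)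
  -- The colouring is chosen as a function of the finset, so adjacent vertices, which have equal
  -- `comp`, use the same one. `f₀` is a default for finsets that are not cliques in `R`.
  obtain ⟨f₀, -⟩ := hL ∅ (by simp) (by simp)
  have : ∀ D : Finset V, ∃ f : V → α, (D : Set V) ⊆ R → G.IsClique D →
      Set.InjOn f D ∧ ∀ x ∈ D, L x (f x) := by
    intro D
    by_cases h : (D : Set V) ⊆ R ∧ G.IsClique D
    · obtain ⟨f, hf⟩ := hL D h.1 h.2
      exact ⟨f, fun _ _ => hf⟩
    · exact ⟨f₀, fun h1 h2 => (h ⟨h1, h2⟩).elim⟩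
  choose f hf using this
  refine ⟨fun x => f (comp x) x, fun x hx => (hf _ (hsub x) (hclique x hx)).2 x (hself x hx),
    fun x hx y hy hxy heq => ?_⟩
  have hc : comp y = comp x :=
    (hle x hx y hy hxy).antisymm (hle y hy x hx hxy.symm)
  simp only [hc] at heq
  exact hxy.ne ((hf _ (hsub x) (hclique x hx)).1 (hself x hx) (hc ▸ hself y hy) heq)

/-- Hall's marriage theorem, with the transversal extended arbitrarily outside `D`. -/
theorem exists_injOn_of_card_le_biUnion {α : Type*} [DecidableEq α] [Nonempty α] (D : Finset V)
    (L : V → Finset α) (h : ∀ T ⊆ D, T.card ≤ (T.biUnion L).card) :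
    ∃ f : V → α, Set.InjOn f D ∧ ∀ x ∈ D, f x ∈ L x := by
  classical
  have := (Finset.all_card_le_biUnion_card_iff_exists_injective (fun x : D => L x)).1 (by
    intro s
    have := h (s.map (Function.Embedding.subtype _)) (by
      intro x hx
      obtain ⟨y, -, rfl⟩ := Finset.mem_map.1 hx
      exact y.2)
    rw [Finset.card_map] at this
    refine this.trans_eq (congrArg _ ?_)
    ext
    simp)
  obtain ⟨f, hf, hfL⟩ := this
  refine ⟨fun x => if hx : x ∈ D then f ⟨x, hx⟩ else Classical.arbitrary α, ?_, ?_⟩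
  · intro x hx y hy hxy
    have hx' : x ∈ D := hx
    have hy' : y ∈ D := hy
    simp only [hx', hy', dif_pos] at hxy
    exact congrArg Subtype.val (hf hxy)
  · intro x hx
    simp only [hx, dif_pos]
    exact hfL ⟨x, hx⟩

theorem exists_injOn_of_card_le {α : Type*} [DecidableEq α] [Nonempty α] (D : Finset V)
    (s : Finset α) (h : D.card ≤ s.card) : ∃ f : V → α, Set.InjOn f D ∧ ∀ x ∈ D, f x ∈ s := by
  refine exists_injOn_of_card_le_biUnion D (fun _ => s) fun T hT => ?_
  rcases T.eq_empty_or_nonempty with rfl | hne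
  · simp
  · obtain ⟨x, hx⟩ := hne
    exact (Finset.card_le_card hT).trans (h.trans (Finset.card_le_card
      (Finset.subset_biUnion_of_mem (fun _ => s) hx)))

/-- The `k`-colouring version of `exists_coloring_of_transOn`, with colours from `s`. -/
theorem exists_coloring_mem_of_transOn [Finite V] {α : Type*} [DecidableEq α] [Nonempty α]
    (R : Set V) (s : Finset α)
    (hR : ∀ x ∈ R, ∀ y ∈ R, ∀ z ∈ R, G.Adj x y → G.Adj y z → x ≠ z → G.Adj x z)
    (hs : ∀ D : Finset V, (D : Set V) ⊆ R → G.IsClique D → D.card ≤ s.card) :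
    ∃ f : V → α, (∀ x ∈ R, f x ∈ s) ∧ ∀ x ∈ R, ∀ y ∈ R, G.Adj x y → f x ≠ f y :=
  exists_coloring_of_transOn R (fun _ c => c ∈ s) hR fun D hD hc =>
    exists_injOn_of_card_le D s (hs D hD hc)

/-! ### The bounds -/

/-- `v` enumerates a clique of `G` of the largest size. -/
structure IsMaxCliqueEnum {n : ℕ} (G : SimpleGraph V) (v : Fin n → V) : Prop where
  adj : ∀ i j, i ≠ j → G.Adj (v i) (v j)
  card_le : ∀ D : Finset V, G.IsClique D → D.card ≤ n

theorem exists_isMaxCliqueEnum [Finite V] (G : SimpleGraph V) {n : ℕ} (h : G.cliqueNum = n) :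
    ∃ v : Fin n → V, IsMaxCliqueEnum G v := by
  obtain ⟨s, hs⟩ := G.exists_isNClique_cliqueNum
  let e := s.equivFinOfCardEq (hs.card_eq.trans h)
  refine ⟨fun i => e.symm i, fun i j hij => ?_, fun D hD => h ▸ hD.card_le_cliqueNum⟩
  exact hs.isClique (e.symm i).2 (e.symm j).2 fun h => hij (e.symm.injective (Subtype.ext h))

namespace IsMaxCliqueEnum

/-! ### Attachment to a maximum clique -/

variable {n : ℕ} {v : Fin n → V} {x y z : V} {i j : Fin n}

theorem injective (hv : IsMaxCliqueEnum G v) : Function.Injective v := fun i j hij => by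
  by_contra h
  exact (hv.adj i j h).ne hij

theorem card_add_one_le (hv : IsMaxCliqueEnum G v) {D : Finset V} (hD : G.IsClique D)
    (hx : ∀ y ∈ D, G.Adj x y) : D.card + 1 ≤ n := by
  classical
  have hxD : x ∉ D := fun h => (hx x h).ne rfl
  rw [← Finset.card_insert_of_notMem hxD]
  refine hv.card_le _ ?_
  rw [Finset.coe_insert, isClique_insert]
  exact ⟨hD, fun y hy _ => hx y hy⟩

/-- With two neighbours in the clique, `x` either sees all of it, against maximality, or misses some
`v k`, and then `x`, `v k` and the two neighbours induce a diamond. -/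
theorem eq_of_adj (hv : IsMaxCliqueEnum G v) (hG : IsFree G) (hx : x ∉ Set.range v)
    (hi : G.Adj x (v i)) (hj : G.Adj x (v j)) : i = j := by
  by_contra hij
  by_cases hall : ∀ k, G.Adj x (v k)
  · have := hv.card_add_one_le (D := Finset.univ.map ⟨v, hv.injective⟩) (x := x) ?_ ?_
    · simp at this
    · rintro _ ha _ hb hab
      simp only [Finset.coe_map, Function.Embedding.coeFn_mk, Finset.coe_univ, Set.image_univ,
        Set.mem_range] at ha hb
      obtain ⟨a, rfl⟩ := ha
      obtain ⟨b, rfl⟩ := hb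
      exact hv.adj a b fun h => hab (h ▸ rfl)
    · simpa using hall
  · push Not at hall
    obtain ⟨k, hk⟩ := hall
    have hki : k ≠ i := fun h => hk (h ▸ hi)
    have hkj : k ≠ j := fun h => hk (h ▸ hj)
    rcases (isFree_iff.1 hG).2 x (v k) (v i) (v j) (hv.adj i j hij) hi hj (hv.adj k i hki)
      (hv.adj k j hkj) with h | h
    · exact hx ⟨k, h.symm⟩
    · exact hk h

open Classical in
/-- The indices of the clique vertices adjacent to `x`. -/
noncomputable def nbrs (G : SimpleGraph V) (v : Fin n → V) (x : V) : Finset (Fin n) :=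
  {i | G.Adj x (v i)}

theorem mem_nbrs : i ∈ nbrs G v x ↔ G.Adj x (v i) := by simp [nbrs]

theorem card_nbrs_le_one (hv : IsMaxCliqueEnum G v) (hG : IsFree G) (hx : x ∉ Set.range v) :
    (nbrs G v x).card ≤ 1 :=
  Finset.card_le_one.2 fun _ hi _ hj => hv.eq_of_adj hG hx (mem_nbrs.1 hi) (mem_nbrs.1 hj)

theorem nbrs_subset_singleton (hv : IsMaxCliqueEnum G v) (hG : IsFree G) (hx : x ∉ Set.range v)
    (hi : G.Adj x (v i)) : nbrs G v x ⊆ {i} := fun _ hj =>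
  Finset.mem_singleton.2 (hv.eq_of_adj hG hx (mem_nbrs.1 hj) hi)

/-- Two clique vertices with indices outside `B` form an edge with no neighbour among `x`, `y`, `z`,
so an induced path on these three would complete P₃ ∪ P₂. -/
theorem trans (hv : IsMaxCliqueEnum G v) (hG : IsFree G) (B : Finset (Fin n)) (hB : B.card + 2 ≤ n)
    (hx : nbrs G v x ⊆ B) (hy : nbrs G v y ⊆ B) (hz : nbrs G v z ⊆ B)
    (hxy : G.Adj x y) (hyz : G.Adj y z) (hne : x ≠ z) : G.Adj x z := by
  have : 1 < Bᶜ.card := by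
    rw [Finset.card_compl, Fintype.card_fin]
    omega
  obtain ⟨i, hi, j, hj, hij⟩ := Finset.one_lt_card.1 this
  rw [Finset.mem_compl] at hi hj
  have h : ∀ w, nbrs G v w ⊆ B → ¬ G.Adj w (v i) ∧ ¬ G.Adj w (v j) := fun w hw =>
    ⟨fun h => hi (hw (mem_nbrs.2 h)), fun h => hj (hw (mem_nbrs.2 h))⟩
  have := (isFree_iff.1 hG).1 x y z (v i) (v j) hxy hyz hne (hv.adj i j hij)
  have := h x hx
  have := h y hy
  have := h z hz
  tauto

/-- Selects the clique vertex that `x` equals or is attached to; the value on far vertices is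
irrelevant. -/
theorem exists_index [NeZero n] (v : Fin n → V) : ∃ g : V → Fin n,
    ∀ x, (x ∈ Set.range v ∨ ∃ i, G.Adj x (v i)) →
      (x = v (g x) ∨ x ∉ Set.range v ∧ G.Adj x (v (g x))) := by
  have : ∀ x, ∃ i : Fin n, (x ∈ Set.range v ∨ ∃ i, G.Adj x (v i)) →
      (x = v i ∨ x ∉ Set.range v ∧ G.Adj x (v i)) := by
    intro x
    by_cases hx : x ∈ Set.range v
    · obtain ⟨i, rfl⟩ := hx
      exact ⟨i, fun _ => .inl rfl⟩
    · by_cases h : ∃ i, G.Adj x (v i)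
      · obtain ⟨i, hi⟩ := h
        exact ⟨i, fun _ => .inr ⟨hx, hi⟩⟩
      · exact ⟨0, fun h' => (h'.elim hx h).elim⟩
  choose g hg using this
  exact ⟨g, hg⟩

/-- The vertices with no neighbour in the clique and not belonging to it. -/
def far (G : SimpleGraph V) (v : Fin n → V) : Set V :=
  {x | ¬ (x ∈ Set.range v ∨ ∃ i, G.Adj x (v i))}

theorem nbrs_eq_empty (hx : x ∈ far G v) : nbrs G v x = ∅ := by
  ext i
  simpa [mem_nbrs] using fun h => hx (.inr ⟨i, h⟩)

theorem notMem_range_of_adj_far (hx : x ∈ far G v) (hxy : G.Adj x y) : y ∉ Set.range v := by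
  rintro ⟨i, rfl⟩
  exact hx (.inr ⟨i, hxy⟩)

theorem colorable_two [Finite V] {v : Fin 2 → V} (hv : IsMaxCliqueEnum G v) (hG : IsFree G) :
    G.Colorable 4 := by
  classical
  obtain ⟨f, hf, hf'⟩ := exists_coloring_mem_of_transOn (G := G) {x | nbrs G v x = ∅}
    ({2, 3} : Finset (Fin 4))
    (fun x hx y hy z hz => hv.trans hG ∅ (by simp) (le_of_eq hx) (le_of_eq hy) (le_of_eq hz))
    (fun D _ hc => hv.card_le D hc)
  have key : ∀ i x y, G.Adj x (v i) → G.Adj y (v i) → ¬ G.Adj x y := by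
    intro i x y hx hy hxy
    have := hv.card_add_one_le (D := {x, y}) (x := v i) (by simpa using fun _ => hxy)
      (by simp [hx.symm, hy.symm])
    rw [Finset.card_pair hxy.ne] at this
    omega
  have hR : ∀ x, ¬ G.Adj x (v 0) → ¬ G.Adj x (v 1) → x ∈ {x | nbrs G v x = ∅} := by
    intro x h0 h1
    ext i
    fin_cases i <;> simp [mem_nbrs, h0, h1]
  -- Here `v 0` gets colour 1 and `v 1` gets colour 0, each being a neighbour of the other.
  refine ⟨Coloring.mk
    (fun x => if G.Adj x (v 0) then 0 else if G.Adj x (v 1) then 1 else f x) fun {x y} hxy => ?_⟩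
  have hx := hf x
  have hy := hf y
  have hxy' := hf' x
  simp only [Finset.mem_insert, Finset.mem_singleton] at hx hy
  by_cases hx0 : G.Adj x (v 0)
  · have hy0 : ¬ G.Adj y (v 0) := fun h => key 0 x y hx0 h hxy
    by_cases hy1 : G.Adj y (v 1)
    · simp [hx0, hy0, hy1]
    · rcases hy (hR y hy0 hy1) with h | h <;> simp [hx0, hy0, hy1, h]
  · by_cases hx1 : G.Adj x (v 1)
    · have hy1 : ¬ G.Adj y (v 1) := fun h => key 1 x y hx1 h hxy
      by_cases hy0 : G.Adj y (v 0)
      · simp [hx0, hx1, hy0]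
      · rcases hy (hR y hy0 hy1) with h | h <;> simp [hx0, hx1, hy0, hy1, h]
    · by_cases hy0 : G.Adj y (v 0)
      · rcases hx (hR x hx0 hx1) with h | h <;> simp [hx0, hx1, hy0, h]
      · by_cases hy1 : G.Adj y (v 1)
        · rcases hx (hR x hx0 hx1) with h | h <;> simp [hx0, hx1, hy0, hy1, h]
        · simpa [hx0, hx1, hy0, hy1] using hf' x (hR x hx0 hx1) y (hR y hy0 hy1) hxy

/-! ### Clique numbers three and four -/

/-- The vertices outside the clique that are adjacent to its `i`-th vertex. -/
def attached (G : SimpleGraph V) (v : Fin n → V) (i : Fin n) : Set V :=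
  {x | x ∉ Set.range v ∧ G.Adj x (v i)}

/-- For `n ≥ 3` the attached set misses two clique vertices, so it is a union of cliques; each of
these extends by `v i`, hence has at most `n - 1` vertices. -/
theorem exists_coloring_attached [Finite V] {α : Type*} [DecidableEq α] [Nonempty α]
    (hv : IsMaxCliqueEnum G v) (hG : IsFree G) (hn : 3 ≤ n) (s : Finset α) (hs : n ≤ s.card + 1)
    (i : Fin n) : ∃ f : V → α, (∀ x ∈ attached G v i, f x ∈ s) ∧
      ∀ x ∈ attached G v i, ∀ y ∈ attached G v i, G.Adj x y → f x ≠ f y := by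
  refine exists_coloring_mem_of_transOn _ s (fun x hx y hy z hz => ?_) fun D hD hc => ?_
  · exact hv.trans hG {i} (by simpa using hn) (hv.nbrs_subset_singleton hG hx.1 hx.2)
      (hv.nbrs_subset_singleton hG hy.1 hy.2) (hv.nbrs_subset_singleton hG hz.1 hz.2)
  · have := hv.card_add_one_le hc (x := v i) fun y hy => (hD hy).2.symm
    omega

/-- The far neighbours of `x` form a clique with it, so there are at most two. Two neighbours
attached to the same `v i` would be adjacent by `trans` and form a diamond with `x` and `v i`, so
there are at most three attached ones. -/
theorem ncard_neighborSet_far_lt_six [Finite V] {v : Fin 3 → V} (hv : IsMaxCliqueEnum G v)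
    (hG : IsFree G) (hx : x ∈ far G v) : (G.neighborSet x).ncard < 6 := by
  classical
  have := Fintype.ofFinite V
  have hfar : (({y | y ∈ G.neighborFinset x ∧ y ∈ far G v} : Finset V)).card + 1 ≤ 3 := by
    refine hv.card_add_one_le (x := x) ?_ (by simp +contextual)
    intro y hy z hz hyz
    simp only [mem_neighborFinset, Finset.mem_coe, Finset.mem_filter, Finset.mem_univ,
      true_and] at hy hz
    exact hv.trans hG ∅ (by simp) (nbrs_eq_empty hy.2).le (nbrs_eq_empty hx).le
      (nbrs_eq_empty hz.2).le hy.1.symm hz.1 hyz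
  have hatt : ∀ i, (({y | y ∈ G.neighborFinset x ∧ y ∈ attached G v i} : Finset V)).card ≤ 1 := by
    intro i
    refine Finset.card_le_one.2 fun y hy z hz => ?_
    simp only [mem_neighborFinset, Finset.mem_filter, Finset.mem_univ, true_and] at hy hz
    by_contra hyz
    have hadj := hv.trans hG {i} (by simp) (hv.nbrs_subset_singleton hG hy.2.1 hy.2.2)
      (by simp [nbrs_eq_empty hx]) (hv.nbrs_subset_singleton hG hz.2.1 hz.2.2) hy.1.symm hz.1 hyz
    rcases (isFree_iff.1 hG).2 x (v i) y z hadj hy.1 hz.1 hy.2.2.symm hz.2.2.symm with h | h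
    · exact hx (.inl ⟨i, h.symm⟩)
    · exact hx (.inr ⟨i, h⟩)
  have hsub : G.neighborFinset x ⊆ ({y | y ∈ G.neighborFinset x ∧ y ∈ far G v} : Finset V) ∪
      Finset.univ.biUnion fun i =>
        ({y | y ∈ G.neighborFinset x ∧ y ∈ attached G v i} : Finset V) := by
    intro y hy
    simp only [Finset.mem_union, Finset.mem_biUnion, Finset.mem_filter, Finset.mem_univ, true_and]
    have hyr := notMem_range_of_adj_far hx ((mem_neighborFinset ..).1 hy)
    by_cases h : y ∈ far G v
    · exact .inl ⟨hy, h⟩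
    · obtain ⟨i, hi⟩ := (not_not.1 h).resolve_left hyr
      exact .inr ⟨i, hy, hyr, hi⟩
  have h1 := (Finset.card_le_card hsub).trans (Finset.card_union_le _ _)
  have h2 := Finset.card_biUnion_le_card_mul Finset.univ (fun i =>
        ({y | y ∈ G.neighborFinset x ∧ y ∈ attached G v i} : Finset V)) 1 fun i _ => hatt i
  rw [Finset.card_univ, Fintype.card_fin] at h2
  rw [← coe_neighborFinset, Set.ncard_coe_finset]
  omega

theorem colorable_three [Finite V] {v : Fin 3 → V} (hv : IsMaxCliqueEnum G v) (hG : IsFree G) :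
    G.Colorable 6 := by
  classical
  choose f _ hf using hv.exists_coloring_attached hG le_rfl (Finset.univ : Finset (Fin 2)) (by simp)
  obtain ⟨g, hg⟩ := exists_index (G := G) v
  obtain ⟨c⟩ := exists_coloring_of_degree_lt (G := G) (far G v)
    -- Each attached set has its own pair of colours. The vertex `v i` borrows from the pair of
    -- index `i + 1`, where it has no neighbours.
    (fun x => if x ∈ Set.range v then (g x + 1, (0 : Fin 2)) else (g x, f (g x) x))
    (fun x hx y hy hxy heq => by
      have hx := hg x (not_not.1 hx)
      have hy := hg y (not_not.1 hy)
      rcases hx with hx | hx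
      · rcases hy with hy | hy
        · have hx' : x ∈ Set.range v := ⟨_, hx.symm⟩
          have hy' : y ∈ Set.range v := ⟨_, hy.symm⟩
          simp only [hx', hy', if_true, Prod.mk.injEq, and_true, add_left_inj] at heq
          rw [heq, ← hy] at hx
          exact hxy.ne hx
        · have hx' : x ∈ Set.range v := ⟨_, hx.symm⟩
          simp only [hx', hy.1, if_true, if_false, Prod.mk.injEq] at heq
          have := hv.eq_of_adj hG hy.1 (hx ▸ hxy.symm) hy.2
          rw [← heq.1] at this
          exact absurd this (by simp)
      · rcases hy with hy | hy
        · have hy' : y ∈ Set.range v := ⟨_, hy.symm⟩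
          simp only [hy', hx.1, if_true, if_false, Prod.mk.injEq] at heq
          have := hv.eq_of_adj hG hx.1 (hy ▸ hxy) hx.2
          rw [heq.1] at this
          exact absurd this (by simp)
        · simp only [hx.1, hy.1, if_false, Prod.mk.injEq] at heq
          rw [← heq.1] at hy heq
          exact hf (g x) x hx y hy hxy heq.2)
    (fun x hx => by simpa using hv.ncard_neighborSet_far_lt_six hG hx)
  simpa using c.colorable

/-- Two neighbours of `x` have at most two clique neighbours together, so two clique vertices remain
for `trans`; thus the neighbourhood of `x` is a clique. -/
theorem ncard_neighborSet_far_lt [Finite V] (hv : IsMaxCliqueEnum G v) (hG : IsFree G) (hn : 4 ≤ n)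
    (hx : x ∈ far G v) : (G.neighborSet x).ncard < n := by
  classical
  have := Fintype.ofFinite V
  rw [← coe_neighborFinset, Set.ncard_coe_finset]
  refine hv.card_add_one_le (x := x) ?_ (by simp)
  intro y hy z hz hyz
  simp only [coe_neighborFinset, mem_neighborSet] at hy hz
  have h1 := hv.card_nbrs_le_one hG (notMem_range_of_adj_far hx hy)
  have h2 := hv.card_nbrs_le_one hG (notMem_range_of_adj_far hx hz)
  have h3 := Finset.card_union_le (nbrs G v y) (nbrs G v z)
  exact hv.trans hG (nbrs G v y ∪ nbrs G v z) (by omega) Finset.subset_union_left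
    (by simp [nbrs_eq_empty hx]) Finset.subset_union_right hy.symm hz hyz

/-- If the neighbourhood of a clique vertex contains an edge off the clique, then no other clique
vertex has a neighbour off the clique. -/
theorem eq_of_mem_attached {v : Fin 4 → V} (hv : IsMaxCliqueEnum G v) (hG : IsFree G)
    {i j : Fin 4} (hx : x ∈ attached G v i) (hy : y ∈ attached G v i) (hxy : G.Adj x y)
    (hz : z ∈ attached G v j) : j = i := by
  by_contra hji
  have hnx := hv.nbrs_subset_singleton hG hx.1 hx.2
  have hny := hv.nbrs_subset_singleton hG hy.1 hy.2
  have hnz := hv.nbrs_subset_singleton hG hz.1 hz.2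
  have hnot : ∀ w, nbrs G v w ⊆ {i} → ∀ k, k ≠ i → ¬ G.Adj w (v k) := fun w hw k hk h =>
    hk (Finset.mem_singleton.1 (hw (mem_nbrs.2 h)))
  obtain ⟨k, hki, hkj⟩ : ∃ k : Fin 4, k ≠ i ∧ k ≠ j := by
    have : ∀ i j : Fin 4, ∃ k, k ≠ i ∧ k ≠ j := by decide
    exact this i j
  have hnzk : ¬ G.Adj z (v k) := fun h =>
    hkj (Finset.mem_singleton.1 (hnz (mem_nbrs.2 h)))
  have hnzi : ¬ G.Adj z (v i) := fun h =>
    hji (Finset.mem_singleton.1 (hnz (mem_nbrs.2 h))).symm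
  have hcard : ({i, j} : Finset (Fin 4)).card + 2 ≤ 4 := by
    rw [Finset.card_pair (Ne.symm hji)]
  have hzx : z ≠ x := fun h => hnzi (h ▸ hx.2)
  have hzy : z ≠ y := fun h => hnzi (h ▸ hy.2)
  have hi : ({i} : Finset (Fin 4)) ⊆ {i, j} := by simp
  have hj : ({j} : Finset (Fin 4)) ⊆ {i, j} := by simp
  -- By `trans`, `z` sees both or neither of `x`, `y`; both gives a diamond with `v i`. Neither
  -- gives P₃ ∪ P₂, from the path `v k`, `v j`, `z` and the edge `x y`.
  have hboth : ¬ (G.Adj z x ∧ G.Adj z y) := by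
    rintro ⟨h1, h2⟩
    rcases (isFree_iff.1 hG).2 z (v i) x y hxy h1 h2 hx.2.symm hy.2.symm with h | h
    · exact hz.1 ⟨i, h.symm⟩
    · exact hnzi h
  have hzx' : ¬ G.Adj z x := fun h => hboth ⟨h, hv.trans hG {i, j} hcard (hnz.trans hj)
    (hnx.trans hi) (hny.trans hi) h hxy hzy⟩
  have hzy' : ¬ G.Adj z y := fun h => hboth ⟨hv.trans hG {i, j} hcard (hnz.trans hj)
    (hny.trans hi) (hnx.trans hi) h hxy.symm hzx, h⟩
  have := (isFree_iff.1 hG).1 (v k) (v j) z x y (hv.adj k j hkj) hz.2.symm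
    (fun h => hz.1 ⟨k, h⟩) hxy
  have hkx := hnot x hnx k hki
  have hky := hnot y hny k hki
  have hjx := hnot x hnx j hji
  have hjy := hnot y hny j hji
  simp only [G.adj_comm (v _)] at this
  tauto

theorem colorable_four [Finite V] {v : Fin 4 → V} (hv : IsMaxCliqueEnum G v) (hG : IsFree G) :
    G.Colorable 4 := by
  classical
  obtain ⟨g, hg⟩ := exists_index (G := G) v
  -- It suffices to colour the attached vertices suitably.
  suffices h : ∃ f : V → Fin 4, (∀ i, ∀ x ∈ attached G v i, f x ≠ i) ∧
      ∀ i j, ∀ x ∈ attached G v i, ∀ y ∈ attached G v j, G.Adj x y → f x ≠ f y by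
    obtain ⟨f, hf, hf'⟩ := h
    obtain ⟨c⟩ := exists_coloring_of_degree_lt (G := G) (far G v)
      (fun x => if x ∈ Set.range v then g x else f x)
      (fun x hx y hy hxy heq => by
        have hx := hg x (not_not.1 hx)
        have hy := hg y (not_not.1 hy)
        rcases hx with hx | hx
        · have hx' : x ∈ Set.range v := ⟨_, hx.symm⟩
          rcases hy with hy | hy
          · have hy' : y ∈ Set.range v := ⟨_, hy.symm⟩
            simp only [hx', hy', if_true] at heq
            rw [heq, ← hy] at hx
            exact hxy.ne hx
          · simp only [hx', hy.1, if_true, if_false] at heq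
            exact hf (g x) y ⟨hy.1, hx ▸ hxy.symm⟩ heq.symm
        · rcases hy with hy | hy
          · have hy' : y ∈ Set.range v := ⟨_, hy.symm⟩
            simp only [hy', hx.1, if_true, if_false] at heq
            exact hf (g y) x ⟨hx.1, hy ▸ hxy⟩ heq
          · simp only [hx.1, hy.1, if_false] at heq
            exact hf' (g x) (g y) x hx y hy hxy heq)
      (fun x hx => by simpa using hv.ncard_neighborSet_far_lt hG le_rfl hx)
    simpa using c.colorable
  by_cases hedge : ∃ i, ∃ x ∈ attached G v i, ∃ y ∈ attached G v i, G.Adj x y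
  · obtain ⟨i, x, hx, y, hy, hxy⟩ := hedge
    obtain ⟨f, hf, hf'⟩ := hv.exists_coloring_attached hG (by simp) (Finset.univ.erase i)
      (by simp) i
    refine ⟨f, fun j z hz => ?_, fun j k z hz w hw => ?_⟩
    · obtain rfl := hv.eq_of_mem_attached hG hx hy hxy hz
      exact Finset.ne_of_mem_erase (hf z hz)
    · obtain rfl := hv.eq_of_mem_attached hG hx hy hxy hz
      obtain rfl := hv.eq_of_mem_attached hG hx hy hxy hw
      exact hf' z hz w hw
  · push Not at hedge
    have hgi : ∀ i, ∀ x ∈ attached G v i, g x = i := fun i x hx => by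
      rcases hg x (.inr ⟨i, hx.2⟩) with h | h
      · exact (hx.1 ⟨_, h.symm⟩).elim
      · exact hv.eq_of_adj hG hx.1 h.2 hx.2
    -- All attached sets are independent here, so each takes a single colour, different from that of
    -- its clique vertex.
    refine ⟨fun x => g x + 1, fun i x hx => ?_, fun i j x hx y hy hxy heq => ?_⟩
    · simp [hgi i x hx]
    · have : i = j := by simpa [hgi i x hx, hgi j y hy] using heq
      subst this
      exact hedge i x hx y hy hxy

theorem isPerfect [Finite V] (hv : IsMaxCliqueEnum G v) (hG : IsFree G) (hn : 5 ≤ n) :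
    IsPerfect G := by
  classical
  have := Fintype.ofFinite V
  intro s
  refine le_antisymm ?_ cliqueNum_le_chromaticNumber
  set k := (G.induce s).cliqueNum with hk
  have hcard : ∀ D : Finset V, (D : Set V) ⊆ s → G.IsClique D → D.card ≤ k := by
    intro D hD hc
    have : (G.induce s).IsClique (D.subtype (· ∈ s) : Finset s) := by
      intro a ha b hb hab
      simp only [Finset.mem_coe, Finset.mem_subtype] at ha hb
      exact hc ha hb fun h => hab (Subtype.ext h)
    have := this.card_le_cliqueNum
    rwa [Finset.card_subtype, Finset.filter_true_of_mem fun x hx => hD hx] at this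
  rcases s.eq_empty_or_nonempty with rfl | ⟨x₀, hx₀⟩
  · exact (Colorable.of_isEmpty k).chromaticNumber_le
  have hk0 : 1 ≤ k := by
    simpa using hcard {x₀} (by simpa using hx₀) (by simp)
  have : NeZero k := ⟨by omega⟩
  let A : Finset V := {x | x ∈ s ∧ x ∈ Set.range v}
  have hA : ∀ x, x ∈ A ↔ x ∈ s ∧ x ∈ Set.range v := by simp [A]
  have hAclique : G.IsClique A := by
    intro a ha b hb hab
    obtain ⟨-, i, rfl⟩ := (hA a).1 ha
    obtain ⟨-, j, rfl⟩ := (hA b).1 hb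
    exact hv.adj i j fun h => hab (h ▸ rfl)
  obtain ⟨l, hl, -⟩ := exists_injOn_of_card_le A (Finset.univ : Finset (Fin k))
    (by simpa using hcard A (fun x hx => ((hA x).1 hx).1) hAclique)
  -- The clique vertices in `s` have distinct colours under `l`. Each component outside the clique
  -- is list-coloured, avoiding at each vertex the colour of its at most one neighbour in `A`.
  obtain ⟨f, hf, hf'⟩ := exists_coloring_of_transOn (G := G) (s \ Set.range v)
    (fun x (c : Fin k) => ∀ a ∈ A, G.Adj x a → l a ≠ c)
    (fun x hx y hy z hz => by
      have h1 := hv.card_nbrs_le_one hG hx.2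
      have h2 := hv.card_nbrs_le_one hG hy.2
      have h3 := hv.card_nbrs_le_one hG hz.2
      have h4 := Finset.card_union_le (nbrs G v x) (nbrs G v y)
      have h5 := Finset.card_union_le (nbrs G v x ∪ nbrs G v y) (nbrs G v z)
      exact hv.trans hG (nbrs G v x ∪ nbrs G v y ∪ nbrs G v z) (by omega)
        (Finset.subset_union_left.trans Finset.subset_union_left)
        (Finset.subset_union_right.trans Finset.subset_union_left) Finset.subset_union_right)
    (fun D hD hc => by
      have huniq : ∀ x ∈ D, ∀ a ∈ A, ∀ b ∈ A, G.Adj x a → G.Adj x b → a = b := by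
        intro x hx a ha b hb hxa hxb
        obtain ⟨-, i, rfl⟩ := (hA a).1 ha
        obtain ⟨-, j, rfl⟩ := (hA b).1 hb
        rw [hv.eq_of_adj hG (hD hx).2 hxa hxb]
      by_cases hshare : ∃ a ∈ A, ∃ x ∈ D, ∃ y ∈ D, x ≠ y ∧ G.Adj x a ∧ G.Adj y a
      -- Diamond-freeness makes the shared neighbour `a` adjacent to all of `D`, so `D` has at most
      -- `k - 1` vertices and the colours other than `l a` suffice.
      · obtain ⟨a, ha, x, hx, y, hy, hxy, hxa, hya⟩ := hshare
        have hall : ∀ z ∈ D, G.Adj z a := by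
          intro z hz
          by_cases hzx : z = x
          · exact hzx ▸ hxa
          by_cases hzy : z = y
          · exact hzy ▸ hya
          rcases (isFree_iff.1 hG).2 z a x y (hc hx hy hxy) (hc hz hx hzx) (hc hz hy hzy)
            hxa.symm hya.symm with h | h
          · exact ((hD hz).2 (h ▸ ((hA a).1 ha).2)).elim
          · exact h
        have haD : a ∉ D := fun h => (hall a h).ne rfl
        have hcardD : (insert a D).card ≤ k := by
          refine hcard _ ?_ ?_
          · rw [Finset.coe_insert, Set.insert_subset_iff]
            exact ⟨((hA a).1 ha).1, fun z hz => (hD hz).1⟩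
          · rw [Finset.coe_insert, isClique_insert]
            exact ⟨hc, fun z hz _ => (hall z hz).symm⟩
        rw [Finset.card_insert_of_notMem haD] at hcardD
        obtain ⟨f, hf, hf'⟩ := exists_injOn_of_card_le D (Finset.univ.erase (l a)) (by
          rw [Finset.card_erase_of_mem (Finset.mem_univ _), Finset.card_univ, Fintype.card_fin]
          omega)
        refine ⟨f, hf, fun z hz b hb hzb => ?_⟩
        rw [huniq z hz b hb a ha hzb (hall z hz)]
        exact (Finset.ne_of_mem_erase (hf' z hz)).symm
      -- Now different vertices of `D` forbid different colours, so any two lists together contain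
      -- all `k` colours. A single list is nonempty, since a vertex with a neighbour in `A` forces
      -- `k ≥ 2`.
      · obtain ⟨f, hf, hf'⟩ := exists_injOn_of_card_le_biUnion D
          (fun x => ({c | ∀ a ∈ A, G.Adj x a → l a ≠ c} : Finset (Fin k))) (fun T hT => by
          rcases Nat.lt_trichotomy T.card 1 with h | h | h
          · omega
          · obtain ⟨x, rfl⟩ := Finset.card_eq_one.1 h
            rw [h, Nat.one_le_iff_ne_zero, ← Nat.pos_iff_ne_zero, Finset.card_pos]
            have hx : x ∈ D := hT (by simp)
            by_cases hxa : ∃ a ∈ A, G.Adj x a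
            · obtain ⟨a, ha, hxa⟩ := hxa
              have h2 := hcard {x, a}
                (by simpa [Set.insert_subset_iff] using ⟨(hD hx).1, ((hA a).1 ha).1⟩)
                (by simpa using fun _ => hxa)
              rw [Finset.card_pair hxa.ne] at h2
              have : Nontrivial (Fin k) := Fin.nontrivial_iff_two_le.2 h2
              obtain ⟨c, hc⟩ := exists_ne (l a)
              refine ⟨c, ?_⟩
              simp only [Finset.singleton_biUnion, Finset.mem_filter, Finset.mem_univ, true_and]
              intro b hb hxb
              rw [huniq x hx b hb a ha hxb hxa]
              exact hc.symm
            · refine ⟨0, ?_⟩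
              simp only [Finset.singleton_biUnion, Finset.mem_filter, Finset.mem_univ, true_and]
              exact fun a ha hxa' => (hxa ⟨a, ha, hxa'⟩).elim
          · obtain ⟨x, hx, y, hy, hxy⟩ := Finset.one_lt_card.1 h
            have : T.biUnion (fun x =>
                ({c | ∀ a ∈ A, G.Adj x a → l a ≠ c} : Finset (Fin k))) = Finset.univ := by
              refine Finset.eq_univ_iff_forall.2 fun c => ?_
              by_contra hcon
              simp only [Finset.mem_biUnion, Finset.mem_filter, Finset.mem_univ, true_and] at hcon
              push Not at hcon
              obtain ⟨a, ha, hxa, hac⟩ := hcon x hx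
              obtain ⟨b, hb, hyb, hbc⟩ := hcon y hy
              obtain rfl := hl ha hb (hac.trans hbc.symm)
              exact hshare ⟨a, ha, x, hT hx, y, hT hy, hxy, hxa, hyb⟩
            rw [this, Finset.card_univ, Fintype.card_fin]
            exact (Finset.card_le_card hT).trans
              (hcard D (fun x hx => (hD hx).1) hc))
        exact ⟨f, hf, fun x hx => by simpa using hf' x hx⟩)
  refine Colorable.chromaticNumber_le ⟨Coloring.mk
    (fun x => if (x : V) ∈ A then l x else f x) fun {x y} hxy => ?_⟩
  have hxy' : G.Adj x y := hxy
  have hmem : ∀ z : s, (z : V) ∉ A → (z : V) ∈ s \ Set.range v := fun z hz =>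
    ⟨z.2, fun h => hz ((hA z).2 ⟨z.2, h⟩)⟩
  by_cases hx : (x : V) ∈ A
  · by_cases hy : (y : V) ∈ A
    · simp only [hx, hy, if_true]
      exact fun h => hxy'.ne (hl hx hy h)
    · simp only [hx, hy, if_true, if_false]
      exact hf y (hmem y hy) x hx hxy'.symm
  · by_cases hy : (y : V) ∈ A
    · simp only [hx, hy, if_true, if_false]
      exact (hf x (hmem x hx) y hy hxy').symm
    · simp only [hx, hy, if_false]
      exact hf' x (hmem x hx) y (hmem y hy) hxy'

end IsMaxCliqueEnum

theorem chromaticNumber_le_and_isPerfect [Finite V] (hG : IsFree G) :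
    (G.cliqueNum = 2 → G.chromaticNumber ≤ 4) ∧
    (G.cliqueNum = 3 → G.chromaticNumber ≤ 6) ∧
    (G.cliqueNum = 4 → G.chromaticNumber ≤ 4) ∧
    (5 ≤ G.cliqueNum → IsPerfect G) := by
  refine ⟨fun h => ?_, fun h => ?_, fun h => ?_, fun h => ?_⟩
  · obtain ⟨v, hv⟩ := exists_isMaxCliqueEnum G h
    exact (hv.colorable_two hG).chromaticNumber_le
  · obtain ⟨v, hv⟩ := exists_isMaxCliqueEnum G h
    exact (hv.colorable_three hG).chromaticNumber_le
  · obtain ⟨v, hv⟩ := exists_isMaxCliqueEnum G h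
    exact (hv.colorable_four hG).chromaticNumber_le
  · obtain ⟨v, hv⟩ := exists_isMaxCliqueEnum G rfl
    exact hv.isPerfect hG h

/-! ### Refuting colourability by exhaustive search

Sets of vertices are bit masks. The recursors are used directly so that the kernel evaluates the
search quickly. -/

/-- All ways of adding the vertex set `v`, whose neighbourhood is `a`, to one of the classes. -/
noncomputable def extensions (v a : ℕ) (cl : List ℕ) : List (List ℕ) :=
  List.rec [] (fun m ms ih => Bool.rec
    (List.rec [] (fun l _ t => (m :: l) :: t) ih)
    ((Nat.lor m v :: ms) :: List.rec [] (fun l _ t => (m :: l) :: t) ih)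
    (Nat.beq (Nat.land m a) 0)) cl

/-- The number of classes disjoint from `a`. -/
noncomputable def extensionCount (a : ℕ) (cl : List ℕ) : ℕ :=
  List.rec 0 (fun m _ ih => Bool.rec ih (Nat.succ ih) (Nat.beq (Nat.land m a) 0)) cl

/-- The entry of `rest` with the fewest extensions, if that number is less than a given one; a
given default otherwise. -/
noncomputable def mostConstrained (cl : List ℕ) (rest : List (ℕ × ℕ)) : ℕ × ℕ → ℕ → ℕ × ℕ :=
  List.rec (fun best _ => best) (fun p _ ih best cnt => Prod.rec (fun v a =>
    (fun c => Bool.rec (ih (v, a) c) (ih best cnt) (Nat.ble cnt c)) (extensionCount a cl)) p) rest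

/-- Whether an exhaustive search of depth `d` shows that the colour classes `cl` do not extend to
a colouring of the vertices in `rest` with at most `k` classes. -/
noncomputable def refute (k : ℕ) (d : ℕ) : List ℕ → List (ℕ × ℕ) → Bool :=
  Nat.rec (fun _ _ => false) (fun _ ih cl rest => Prod.rec (fun v a => (fun rest' =>
      and (List.rec true (fun cl' _ t => and (ih cl' rest') t) (extensions v a cl))
        (Bool.rec true (ih (cl ++ [v]) rest') (Nat.blt cl.length k)))
      (List.rec [] (fun q _ t => Bool.rec (q :: t) t (Nat.beq q.1 v)) rest))
    (mostConstrained cl rest (0, 0) (k + 1))) d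

theorem extensions_cons (v a m : ℕ) (ms : List ℕ) : extensions v a (m :: ms) =
    if m &&& a = 0 then ((m ||| v) :: ms) :: (extensions v a ms).map (m :: ·)
    else (extensions v a ms).map (m :: ·) := by
  have hmap : ∀ L : List (List ℕ),
      (List.rec [] (fun l _ t => (m :: l) :: t) L : List (List ℕ)) = L.map (m :: ·) := by
    intro L
    induction L with
    | nil => rfl
    | cons l L ih => simpa using ih
  change (Bool.rec (List.rec [] (fun l _ t => (m :: l) :: t) (extensions v a ms))
    (((m ||| v) :: ms) :: List.rec [] (fun l _ t => (m :: l) :: t) (extensions v a ms))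
    (Nat.beq (m &&& a) 0) : List (List ℕ)) = _
  rw [hmap]
  by_cases h : m &&& a = 0
  · rw [if_pos h, h]
    rfl
  · rw [if_neg h, Bool.eq_false_iff.2 fun h' => h (Nat.eq_of_beq_eq_true h')]

/-! ### Soundness of the search -/

variable {α : Type*}

/-- The mask `m` is contained in the class of colour `c`. -/
def InClass (col : ℕ → α) (m : ℕ) (c : α) : Prop :=
  ∀ j, m.testBit j = true → col j = c

/-- In the colouring `col`, all of `p.1` has one colour, which does not occur on `p.2`. -/
def IsEntry (col : ℕ → α) (p : ℕ × ℕ) : Prop :=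
  ∃ c, InClass col p.1 c ∧ ∀ j, p.2.testBit j = true → col j ≠ c

theorem InClass.lor {col : ℕ → α} {m v : ℕ} {c : α} (hm : InClass col m c)
    (hv : InClass col v c) : InClass col (m ||| v) c := fun j hj => by
  rw [Nat.testBit_or, Bool.or_eq_true] at hj
  exact hj.elim (hm j) (hv j)

theorem exists_mem_extensions {col : ℕ → α} {v a : ℕ} {c : α} (hv : InClass col v c)
    (ha : ∀ j, a.testBit j = true → col j ≠ c) {cl : List ℕ} {cs : List α}
    (h : List.Forall₂ (InClass col) cl cs) (hc : c ∈ cs) :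
    ∃ cl' ∈ extensions v a cl, List.Forall₂ (InClass col) cl' cs := by
  induction h with
  | nil => simp at hc
  | @cons m d ms ds hm hms ih =>
    rw [extensions_cons]
    by_cases hcd : c = d
    · subst hcd
      have : m &&& a = 0 := by
        refine Nat.eq_of_testBit_eq fun j => ?_
        rw [Nat.testBit_and, Nat.zero_testBit, Bool.and_eq_false_iff]
        by_contra! hj
        simp only [ne_eq, Bool.not_eq_false] at hj
        exact ha j hj.2 (hm j hj.1)
      rw [if_pos this]
      exact ⟨_, List.mem_cons_self, .cons (hm.lor hv) hms⟩
    · obtain ⟨cl', hcl', hf⟩ := ih ((List.mem_cons.1 hc).resolve_left hcd)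
      refine ⟨m :: cl', ?_, .cons hm hf⟩
      have := List.mem_map_of_mem (f := (m :: ·)) hcl'
      split_ifs
      · exact List.mem_cons_of_mem _ this
      · exact this

theorem isEntry_mostConstrained {col : ℕ → α} (cl : List ℕ) {rest : List (ℕ × ℕ)}
    (h : ∀ p ∈ rest, IsEntry col p) : ∀ (best : ℕ × ℕ) (cnt : ℕ), IsEntry col best →
      IsEntry col (mostConstrained cl rest best cnt) := by
  induction rest with
  | nil => exact fun _ _ hb => hb
  | cons p ps ih =>
    intro best cnt hb
    have ih := ih fun q hq => h q (List.mem_cons_of_mem _ hq)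
    change IsEntry col (Bool.rec (mostConstrained cl ps p (extensionCount p.2 cl))
      (mostConstrained cl ps best cnt) (Nat.ble cnt (extensionCount p.2 cl)))
    cases Nat.ble cnt (extensionCount p.2 cl)
    · exact ih _ _ (h p List.mem_cons_self)
    · exact ih _ _ hb

theorem refute_succ (k d : ℕ) (cl : List ℕ) (rest : List (ℕ × ℕ))
    (h : refute k (d + 1) cl rest = true) : ∃ rest' : List (ℕ × ℕ), rest' ⊆ rest ∧
      (∀ cl' ∈ extensions (mostConstrained cl rest (0, 0) (k + 1)).1
        (mostConstrained cl rest (0, 0) (k + 1)).2 cl, refute k d cl' rest' = true) ∧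
      (cl.length < k →
        refute k d (cl ++ [(mostConstrained cl rest (0, 0) (k + 1)).1]) rest' = true) := by
  generalize hp : mostConstrained cl rest (0, 0) (k + 1) = p
  let rest' : List (ℕ × ℕ) :=
    List.rec [] (fun q _ t => Bool.rec (q :: t) t (Nat.beq q.1 p.1)) rest
  have h' : and (List.rec true (fun cl' _ t => and (refute k d cl' rest') t)
      (extensions p.1 p.2 cl))
      (Bool.rec true (refute k d (cl ++ [p.1]) rest') (Nat.blt cl.length k)) = true := by
    subst hp
    exact h
  rw [Bool.and_eq_true] at h'
  refine ⟨rest', ?_, ?_, fun hlt => ?_⟩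
  · clear h h' hp
    subst rest'
    induction rest with
    | nil => exact fun _ h => h
    | cons q qs ih =>
      cases hq : Nat.beq q.1 p.1
      · simpa [hq] using List.Subset.trans ih (List.subset_cons_self _ _)
      · simpa [hq] using List.Subset.trans ih (List.subset_cons_self _ _)
  · have h1 := h'.1
    generalize extensions p.1 p.2 cl = E at h1
    induction E with
    | nil => simp
    | cons e E ih =>
      have h1' := (Bool.and_eq_true _ _).mp h1
      intro cl' hcl'
      rcases List.mem_cons.1 hcl' with rfl | hcl'
      · exact h1'.1
      · exact ih h1'.2 cl' hcl'
  · have h2 := h'.2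
    have : Nat.blt cl.length k = true := Nat.ble_eq_true_of_le hlt
    rw [this] at h2
    exact h2

/-- Some branch of the search follows `col`: its classes lie in distinct colour classes of `col`,
listed in `cs`. Such a branch is never refuted, and depth zero refutes nothing. The choice of the
next vertex affects only speed. -/
theorem refute_sound [Fintype α] [Nonempty α] {col : ℕ → α} {k : ℕ} (hk : Fintype.card α ≤ k)
    (d : ℕ) : ∀ (cl : List ℕ) (rest : List (ℕ × ℕ)) (cs : List α), cs.Nodup →
      List.Forall₂ (InClass col) cl cs → (∀ p ∈ rest, IsEntry col p) →
      refute k d cl rest = false := by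
  induction d with
  | zero => exact fun _ _ _ _ _ _ => rfl
  | succ d ih =>
    intro cl rest cs hcs hcl hrest
    by_contra h
    rw [Bool.not_eq_false] at h
    obtain ⟨rest', hsub, hext, hnew⟩ := refute_succ k d cl rest h
    have hrest' : ∀ p ∈ rest', IsEntry col p := fun p hp => hrest p (hsub hp)
    -- The default `(0, 0)` has empty masks, so it is an entry vacuously.
    obtain ⟨c, hv, ha⟩ := isEntry_mostConstrained cl hrest (0, 0) (k + 1)
      ⟨Classical.arbitrary α, by simp [InClass], by simp⟩
    by_cases hc : c ∈ cs
    · obtain ⟨cl', hcl', hf⟩ := exists_mem_extensions hv ha hcl hc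
      simpa [hext cl' hcl'] using ih cl' rest' cs hcs hf hrest'
    · have hnodup : (cs ++ [c]).Nodup := by
        rw [List.nodup_append]
        exact ⟨hcs, List.nodup_singleton c, fun a ha b hb h => hc (List.mem_singleton.1 hb ▸ h ▸ ha)⟩
      have hlen := hnodup.length_le_card
      rw [List.length_append, List.length_singleton] at hlen
      have hlt : cl.length < k := by
        rw [hcl.length_eq]
        omega
      simpa [hnew hlt] using ih _ rest' (cs ++ [c]) hnodup
        (List.rel_append hcl (.cons hv .nil)) hrest'

/-- `w` enumerates the vertices of `G`, and `T` lists their neighbourhoods as bit masks. -/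
structure IsMaskTable {n : ℕ} (G : SimpleGraph V) (w : Fin n → V) (T : List ℕ) : Prop where
  surjective : Function.Surjective w
  adj_iff : ∀ i j, G.Adj (w i) (w j) ↔ (T.getD i 0).testBit j = true
  lt : ∀ i : Fin n, T.getD i 0 < 2 ^ n

theorem IsMaskTable.not_colorable {n k : ℕ} {w : Fin n → V} {T : List ℕ} (h : IsMaskTable G w T)
    (hn : 0 < n)
    (hr : refute k n [] ((List.range n).map fun i => (2 ^ i, T.getD i 0)) = true) :
    ¬ G.Colorable k := by
  rintro ⟨C⟩
  have : Nonempty (Fin k) := ⟨C (w ⟨0, hn⟩)⟩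
  let col : ℕ → Fin k := fun j => if hj : j < n then C (w ⟨j, hj⟩) else Classical.arbitrary _
  have := refute_sound (col := col) (Fintype.card_fin k).le n []
    ((List.range n).map fun i => (2 ^ i, T.getD i 0)) [] List.nodup_nil .nil (by
      intro p hp
      obtain ⟨i, hi, rfl⟩ := List.mem_map.1 hp
      rw [List.mem_range] at hi
      refine ⟨C (w ⟨i, hi⟩), fun j hj => ?_, fun j hj => ?_⟩
      · rw [Nat.testBit_two_pow, decide_eq_true_eq] at hj
        subst hj
        simp [col, hi]
      -- The table has no bits at or above `n`, so the arbitrary values of `col` play no role.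
      · have hjn : j < n := by
          by_contra hjn
          have := Nat.testBit_lt_two_pow ((h.lt ⟨i, hi⟩).trans_le
            (Nat.pow_le_pow_right two_pos (not_lt.1 hjn)))
          exact absurd (hj.symm.trans this) (by simp)
        simp only [col, hjn, dif_pos]
        exact (C.valid ((h.adj_iff ⟨i, hi⟩ ⟨j, hjn⟩).2 hj)).symm)
  exact absurd (hr.symm.trans this) (by simp)

theorem cliqueNum_eq {n : ℕ} [Finite V] (s : Finset V) (hs : G.IsNClique n s)
    (h : G.CliqueFree (n + 1)) : G.cliqueNum = n := by
  refine le_antisymm ?_ (hs.card_eq ▸ hs.isClique.card_le_cliqueNum)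
  obtain ⟨t, ht⟩ := G.exists_isNClique_cliqueNum
  by_contra hlt
  exact h.mono (by omega : n + 1 ≤ G.cliqueNum) t ht

theorem chromaticNumber_eq_succ {n : ℕ} (h : G.chromaticNumber ≤ (n + 1 : ℕ))
    (h' : ¬ G.Colorable n) : G.chromaticNumber = (n + 1 : ℕ) :=
  chromaticNumber_eq_iff_colorable_not_colorable.2 ⟨chromaticNumber_le_iff_colorable.1 h, h'⟩

/-! ### The Grötzsch graph -/

instance (G : SimpleGraph V) [DecidableRel G.Adj] : DecidableRel (mycielskian G).Adj
  | .inl u, .inl v => inferInstanceAs (Decidable (G.Adj u v))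
  | .inl u, .inr (.inl v) => inferInstanceAs (Decidable (G.Adj u v))
  | .inr (.inl u), .inl v => inferInstanceAs (Decidable (G.Adj u v))
  | .inr (.inl _), .inr (.inr _) => .isTrue trivial
  | .inr (.inr _), .inr (.inl _) => .isTrue trivial
  | .inl _, .inr (.inr _) => .isFalse id
  | .inr (.inl _), .inr (.inl _) => .isFalse id
  | .inr (.inr _), .inl _ => .isFalse id
  | .inr (.inr _), .inr (.inr _) => .isFalse id

/-- The vertices of the Grötzsch graph. -/
def grotzschVertex : Fin 11 → Fin 5 ⊕ (Fin 5 ⊕ Unit) :=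
  ![.inl 0, .inl 1, .inl 2, .inl 3, .inl 4, .inr (.inl 0), .inr (.inl 1), .inr (.inl 2),
    .inr (.inl 3), .inr (.inl 4), .inr (.inr ())]

/-- The neighbourhoods in the Grötzsch graph. -/
def grotzschTable : List ℕ := [594, 165, 330, 660, 297, 1042, 1029, 1034, 1044, 1033, 992]

theorem isMaskTable_grotzsch : IsMaskTable grotzschGraph grotzschVertex grotzschTable where
  surjective := by
    unfold Function.Surjective
    decide +kernel
  adj_iff := by
    unfold grotzschGraph
    decide +kernel
  lt := by decide +kernel

theorem grotzsch_triangleFree (x y z : Fin 5 ⊕ (Fin 5 ⊕ Unit)) (hxy : grotzschGraph.Adj x y)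
    (hxz : grotzschGraph.Adj x z) : ¬ grotzschGraph.Adj y z := by
  obtain ⟨i, rfl⟩ := isMaskTable_grotzsch.surjective x
  obtain ⟨j, rfl⟩ := isMaskTable_grotzsch.surjective y
  obtain ⟨k, rfl⟩ := isMaskTable_grotzsch.surjective z
  rw [isMaskTable_grotzsch.adj_iff] at *
  have : ∀ i j : Fin 11, (grotzschTable.getD i 0).testBit j = true →
      ∀ k : Fin 11, (grotzschTable.getD i 0).testBit k = true →
        ¬ (grotzschTable.getD j 0).testBit k = true := by decide +kernel
  exact this i j hxy k hxz

set_option synthInstance.maxSize 2000 in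
theorem isFree_grotzschGraph : IsFree grotzschGraph := by
  refine isFree_iff.2 ⟨fun a b c d e hab hbc hac hde => ?_, fun a b c d hcd hac had => ?_⟩
  · obtain ⟨a, rfl⟩ := isMaskTable_grotzsch.surjective a
    obtain ⟨b, rfl⟩ := isMaskTable_grotzsch.surjective b
    obtain ⟨c, rfl⟩ := isMaskTable_grotzsch.surjective c
    obtain ⟨d, rfl⟩ := isMaskTable_grotzsch.surjective d
    obtain ⟨e, rfl⟩ := isMaskTable_grotzsch.surjective e
    simp only [isMaskTable_grotzsch.adj_iff] at *
    -- Hypotheses are interleaved with the quantifiers so that the evaluation prunes early.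
    have : ∀ d e : Fin 11, (grotzschTable.getD d 0).testBit e = true →
        ∀ b : Fin 11, ¬ (grotzschTable.getD b 0).testBit d = true →
          ¬ (grotzschTable.getD b 0).testBit e = true →
        ∀ a : Fin 11, (grotzschTable.getD a 0).testBit b = true →
          ¬ (grotzschTable.getD a 0).testBit d = true →
          ¬ (grotzschTable.getD a 0).testBit e = true →
        ∀ c : Fin 11, (grotzschTable.getD b 0).testBit c = true →
          ¬ (grotzschTable.getD c 0).testBit d = true →
          ¬ (grotzschTable.getD c 0).testBit e = true → a = c := by decide +kernel
    by_contra! hn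
    obtain ⟨-, h1, h2, h3, h4, h5, h6⟩ := hn
    exact hac (congrArg _ (this d e hde b h3 h4 a hab h1 h2 c hbc h5 h6))
  · exact (grotzsch_triangleFree a c d hac had hcd).elim

theorem cliqueNum_grotzschGraph : grotzschGraph.cliqueNum = 2 := by
  refine cliqueNum_eq {.inl 0, .inl 1} ⟨?_, rfl⟩ fun t ht => ?_
  · have : grotzschGraph.Adj (.inl 0) (.inl 1) := by
      unfold grotzschGraph
      decide
    simpa using this
  · obtain ⟨a, b, c, hab, hac, hbc, -⟩ := is3Clique_iff.1 ht
    exact grotzsch_triangleFree a b c hab hac hbc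

theorem chromaticNumber_grotzschGraph : grotzschGraph.chromaticNumber = 4 :=
  chromaticNumber_eq_succ ((chromaticNumber_le_and_isPerfect isFree_grotzschGraph).1
    cliqueNum_grotzschGraph) (isMaskTable_grotzsch.not_colorable (by simp) (by decide +kernel))

/-! ### The complement of the Schläfli graph -/

instance : DecidableRel Line.Meets
  | .a _, .a _ => .isFalse id
  | .a i, .b j => inferInstanceAs (Decidable (i ≠ j))
  | .a i, .c s => inferInstanceAs (Decidable (i ∈ s.1))
  | .b i, .a j => inferInstanceAs (Decidable (i ≠ j))
  | .b _, .b _ => .isFalse id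
  | .b i, .c s => inferInstanceAs (Decidable (i ∈ s.1))
  | .c s, .a i => inferInstanceAs (Decidable (i ∈ s.1))
  | .c s, .b i => inferInstanceAs (Decidable (i ∈ s.1))
  | .c s, .c t => inferInstanceAs (Decidable (Disjoint s.1 t.1))

theorem Line.not_meets_self : ∀ x : Line, ¬ x.Meets x := by
  rintro (i | i | ⟨s, hs⟩) h
  · exact h
  · exact h
  · have h : Disjoint s s := h
    rw [disjoint_self] at h
    subst h
    simp at hs

theorem schlafliGraph_compl_adj {x y : Line} : schlafliGraphᶜ.Adj x y ↔ x.Meets y := by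
  have : x.Meets y → x ≠ y := by
    rintro h rfl
    exact x.not_meets_self h
  rw [compl_adj]
  simp only [schlafliGraph]
  tauto

/-- The 27 lines. -/
def lines : Fin 27 → Line :=
  ![.a 0, .a 1, .a 2, .a 3, .a 4, .a 5, .b 0, .b 1, .b 2, .b 3, .b 4, .b 5, .c ⟨{0, 1}, rfl⟩,
    .c ⟨{0, 2}, rfl⟩, .c ⟨{0, 3}, rfl⟩, .c ⟨{0, 4}, rfl⟩, .c ⟨{0, 5}, rfl⟩, .c ⟨{1, 2}, rfl⟩,
    .c ⟨{1, 3}, rfl⟩, .c ⟨{1, 4}, rfl⟩, .c ⟨{1, 5}, rfl⟩, .c ⟨{2, 3}, rfl⟩, .c ⟨{2, 4}, rfl⟩,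
    .c ⟨{2, 5}, rfl⟩, .c ⟨{3, 4}, rfl⟩, .c ⟨{3, 5}, rfl⟩, .c ⟨{4, 5}, rfl⟩]

/-- For each of the 27 lines, the lines that meet it. -/
def meetsTable : List ℕ :=
  [130944, 1974080, 14823104, 52710848, 88640448, 110168000, 127038, 1970237, 14819387, 52707383,
    88637487, 110166047, 132120771, 119275845, 81396297, 45483089, 23988321, 117555590, 79798922,
    44131474, 23128226, 68784908, 34952468, 17619236, 9647640, 4897320, 2522160]

/-- The index set of a line `c s`. -/
def Line.indices : Line → Finset (Fin 6)
  | .a _ => ∅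
  | .b _ => ∅
  | .c s => s.1

theorem lines_surjective : Function.Surjective lines := by
  -- A two-element index set determines a line, since the lines `a i` and `b i` have empty index
  -- set.
  have h : ∀ s : Finset (Fin 6), s.card = 2 → ∃ i : Fin 27, (lines i).indices = s := by
    decide +kernel
  rintro (i | i | ⟨s, hs⟩)
  · exact ⟨⟨i, by omega⟩, by fin_cases i <;> rfl⟩
  · exact ⟨⟨i + 6, by omega⟩, by fin_cases i <;> rfl⟩
  · obtain ⟨i, hi⟩ := h s hs
    refine ⟨i, ?_⟩
    generalize lines i = x at hi
    subst hi
    rcases x with j | j | t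
    · simp [Line.indices] at hs
    · simp [Line.indices] at hs
    · rfl

theorem isMaskTable_meets : IsMaskTable schlafliGraphᶜ lines meetsTable where
  surjective := lines_surjective
  adj_iff := by
    simp only [schlafliGraph_compl_adj]
    decide +kernel
  lt := by decide +kernel

theorem Line.eq_of_meets (x y z t : Line) (hxy : x.Meets y) (hxz : x.Meets z) (hyz : y.Meets z)
    (hxt : x.Meets t) (hyt : y.Meets t) : z = t := by
  obtain ⟨i, rfl⟩ := lines_surjective x
  obtain ⟨j, rfl⟩ := lines_surjective y
  obtain ⟨k, rfl⟩ := lines_surjective z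
  obtain ⟨l, rfl⟩ := lines_surjective t
  simp only [← schlafliGraph_compl_adj, isMaskTable_meets.adj_iff] at *
  have : ∀ i j : Fin 27, (meetsTable.getD i 0).testBit j = true →
      ∀ k : Fin 27, (meetsTable.getD i 0).testBit k = true →
        (meetsTable.getD j 0).testBit k = true →
      ∀ l : Fin 27, (meetsTable.getD i 0).testBit l = true →
        (meetsTable.getD j 0).testBit l = true → k = l := by decide +kernel
  rw [this i j hxy k hxz hyz l hxt hyt]

theorem Line.exists_tritangent (x y : Line) (hxy : x.Meets y) :
    ∃ z, x.Meets z ∧ y.Meets z ∧ ∀ t : Line, t.Meets x ∨ t.Meets y ∨ t.Meets z := by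
  obtain ⟨i, rfl⟩ := lines_surjective x
  obtain ⟨j, rfl⟩ := lines_surjective y
  rw [lines_surjective.exists]
  simp only [lines_surjective.forall, ← schlafliGraph_compl_adj, isMaskTable_meets.adj_iff] at *
  have : ∀ i j : Fin 27, (meetsTable.getD i 0).testBit j = true →
      ∃ k : Fin 27, (meetsTable.getD i 0).testBit k = true ∧
        (meetsTable.getD j 0).testBit k = true ∧ ∀ l : Fin 27,
          (meetsTable.getD l 0).testBit i = true ∨ (meetsTable.getD l 0).testBit j = true ∨
            (meetsTable.getD l 0).testBit k = true := by decide +kernel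
  exact this i j hxy

theorem isFree_schlafliGraph_compl : IsFree schlafliGraphᶜ := by
  rw [isFree_iff]
  simp only [schlafliGraph_compl_adj]
  refine ⟨fun a b c d e hab hbc hac hde => ?_, fun a b c d hcd hac had hbc hbd => ?_⟩
  -- If `a`, `b`, `c` all miss `d` and `e`, they all meet the third line `f` of the triangle. Then
  -- `a` and `c` both complete the edge `b f` to a triangle, so they coincide.
  · obtain ⟨f, -, -, hf⟩ := Line.exists_tritangent d e hde
    by_contra! hn
    obtain ⟨-, h1, h2, h3, h4, h5, h6⟩ := hn
    have ha := ((hf a).resolve_left h1).resolve_left h2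
    have hb := ((hf b).resolve_left h3).resolve_left h4
    have hc := ((hf c).resolve_left h5).resolve_left h6
    exact hac (Line.eq_of_meets b f a c hb hab.symm ha.symm hbc hc.symm)
  · exact .inl (Line.eq_of_meets c d a b hcd hac.symm had.symm hbc.symm hbd.symm)

instance : Finite Line := Finite.of_surjective _ lines_surjective

theorem cliqueNum_schlafliGraph_compl : schlafliGraphᶜ.cliqueNum = 3 := by
  classical
  obtain ⟨z, h0, h1, -⟩ := Line.exists_tritangent (.a 0) (.b 1) (by decide)
  refine cliqueNum_eq {.a 0, .b 1, z} (is3Clique_iff.2 ⟨.a 0, .b 1, z, ?_, ?_, ?_, rfl⟩)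
    fun t ht => ?_
  · exact schlafliGraph_compl_adj.2 (by decide)
  · exact schlafliGraph_compl_adj.2 h0
  · exact schlafliGraph_compl_adj.2 h1
  -- In a 4-clique the edge `a b` would lie in two triangles.
  · obtain ⟨a, u, hau, rfl, hu⟩ := Finset.card_eq_succ.1 ht.card_eq
    have hc := ht.isClique
    rw [Finset.coe_insert, isClique_insert] at hc
    obtain ⟨b, c, d, hbc, hbd, hcd, rfl⟩ := is3Clique_iff.1 ⟨hc.1, hu⟩
    simp only [Finset.mem_insert, Finset.mem_singleton, not_or] at hau
    have hab := hc.2 b (by simp) hau.1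
    have hac := hc.2 c (by simp) hau.2.1
    have had := hc.2 d (by simp) hau.2.2
    simp only [schlafliGraph_compl_adj] at hab hac had hbc hbd hcd
    exact c.not_meets_self (Line.eq_of_meets a b d c hab had hbd hac hbc ▸ hcd)

theorem chromaticNumber_schlafliGraph_compl : schlafliGraphᶜ.chromaticNumber = 6 :=
  chromaticNumber_eq_succ ((chromaticNumber_le_and_isPerfect isFree_schlafliGraph_compl).2.1
    cliqueNum_schlafliGraph_compl)
    (isMaskTable_meets.not_colorable (by simp) (by decide +kernel))

/-! ### Complete graphs -/

theorem isFree_top : IsFree (⊤ : SimpleGraph V) :=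
  isFree_iff.2 ⟨fun _ _ _ _ _ _ _ h _ => .inl h, fun a b _ _ _ _ _ _ _ => em (a = b)⟩

theorem cliqueNum_top_fin (n : ℕ) : (⊤ : SimpleGraph (Fin n)).cliqueNum = n := by
  have h1 : (Finset.univ : Finset (Fin n)).card ≤ (⊤ : SimpleGraph (Fin n)).cliqueNum :=
    IsClique.card_le_cliqueNum (tc := by simp [IsClique, Set.Pairwise])
  have h2 := cliqueNum_le_chromaticNumber (G := (⊤ : SimpleGraph (Fin n)))
  rw [chromaticNumber_top] at h2
  simp only [Finset.card_univ, Fintype.card_fin, Nat.cast_le] at h1 h2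
  omega

end PThreePTwo

theorem theorem4p5 :
    (∀ (V : Type*) [Finite V] (G : SimpleGraph V), PThreePTwo.IsFree G →
      (G.cliqueNum = 2 → G.chromaticNumber ≤ 4) ∧
      (G.cliqueNum = 3 → G.chromaticNumber ≤ 6) ∧
      (G.cliqueNum = 4 → G.chromaticNumber ≤ 4) ∧
      (5 ≤ G.cliqueNum → PThreePTwo.IsPerfect G)) ∧
    (PThreePTwo.IsFree PThreePTwo.grotzschGraph ∧
      PThreePTwo.grotzschGraph.cliqueNum = 2 ∧
      PThreePTwo.grotzschGraph.chromaticNumber = 4) ∧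
    (PThreePTwo.IsFree PThreePTwo.schlafliGraphᶜ ∧
      PThreePTwo.schlafliGraphᶜ.cliqueNum = 3 ∧
      PThreePTwo.schlafliGraphᶜ.chromaticNumber = 6) ∧
    (∀ n : ℕ, 4 ≤ n →
      PThreePTwo.IsFree (⊤ : SimpleGraph (Fin n)) ∧
      (⊤ : SimpleGraph (Fin n)).cliqueNum = n ∧
      (⊤ : SimpleGraph (Fin n)).chromaticNumber = n) := by
  refine ⟨fun V _ G hG => PThreePTwo.chromaticNumber_le_and_isPerfect hG,
    ⟨PThreePTwo.isFree_grotzschGraph, PThreePTwo.cliqueNum_grotzschGraph,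
      PThreePTwo.chromaticNumber_grotzschGraph⟩,
    ⟨PThreePTwo.isFree_schlafliGraph_compl, PThreePTwo.cliqueNum_schlafliGraph_compl,
      PThreePTwo.chromaticNumber_schlafliGraph_compl⟩,
    fun n _ => ⟨PThreePTwo.isFree_top, PThreePTwo.cliqueNum_top_fin n, ?_⟩⟩
  rw [SimpleGraph.chromaticNumber_top, Fintype.card_fin]
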